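/- Consider a source with one antenna, a full-duplex decode-and-forward relay with $M_R>1$ receive and $M_T\ge 1$ transmit antennas, and a destination with one antenna. The channels are $h_{SR}\in\mathbb C^{M_R\times 1}$, $H_{RR}\in\mathbb C^{M_R\times M_T}$ (loopback) and $h_{RD}\in\mathbb C^{1\times M_T}$. All their entries are independent and circularly symmetric complex Gaussian, with mean $0$ and variance $1$ for $h_{SR}$ and $h_{RD}$, and variance $\sigma^2>0$ for $H_{RR}$. Let $d_1,d_2>0$ be the distances, $\tau$ the path-loss exponent, $0<\alpha<1$ the energy-harvesting time fraction, $\eta>0$ the energy conversion efficiency, and $\kappa=\eta\alpha/(1-\alpha)$. For source transmit power $\rho_1>0$ (noise has unit variance), a receive combiner $w_r$ (row) and a transmit beamformer $w_t$ (column), the end-to-end SINR is $$\gamma=\min\left(\frac{\rho_1|w_r h_{SR}|^2}{\kappa\rho_1\|h_{SR}\|^2|w_rH_{RR}w_t|^2+d_1^{\tau}},\ \frac{\kappa\rho_1}{d_1^{\tau}d_2^{\tau}}\|h_{SR}\|^2|h_{RD}w_t|^2\right).$$ In the receive zero-forcing scheme, $w_t=h_{RD}^\dagger/\|h_{RD}\|$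 and $w_r=(Dh_{SR})^\dagger/\|Dh_{SR}\|$, where $D=I-H_{RR}h_{RD}^\dagger h_{RD}H_{RR}^\dagger/\|H_{RR}h_{RD}^\dagger\|^2$. Let $\gamma_{\mathrm{RZF}}$ be the resulting SINR, let $z>0$ be a fixed threshold, and let $F(\rho_1)=\Pr(\gamma_{\mathrm{RZF}}<z)$ be the outage probability. Then, as $\rho_1\to\infty$ with all other parameters fixed (where $\sim$ means that the ratio tends to $1$), $$F(\rho_1)\sim\begin{cases}\dfrac{1}{\Gamma(M_R)}\left(\dfrac{d_1^\tau z}{\rho_1}\right)^{M_R-1}, & M_R<M_T+1,\\[2ex] \dfrac{1}{\Gamma(M_R)}\left(1+\dfrac{1}{\Gamma(M_T+1)}\left(\dfrac{d_2^\tau}{\kappa}\right)^{M_T}\right)\left(\dfrac{d_1^\tau z}{\rho_1}\right)^{M_T}, & M_R=M_T+1,\\[2ex] \dfrac{\Gamma(M_R-M_T)}{\Gamma(M_R)\Gamma(M_T+1)}\left(\dfrac{d_2^\tau}{\kappa}\right)^{M_T}\left(\dfrac{d_1^\tau z}{\rho_1}\right)^{M_T}, & M_R>M_T+1.\end{cases}$$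 In particular the diversity order is $\min(M_R-1,M_T)$, that is, $-\log F(\rho_1)/\log\rho_1\to\min(M_R-1,M_T)$ as $\rho_1\to\infty$. -/

import Mathlib

open MeasureTheory ProbabilityTheory Filter Topology Asymptotics
open scoped NNReal Matrix

noncomputable section

namespace FDRelay

/-- The circularly symmetric complex Gaussian law `CN(0, v)`: independent real and imaginary
parts, each centered Gaussian with variance `v / 2`. -/
def complexGaussian (v : ℝ≥0) : Measure ℂ :=
  ((gaussianReal 0 (v / 2)).prod (gaussianReal 0 (v / 2))).map
    Complex.measurableEquivRealProd.symm

instance instIsProbabilityMeasureComplexGaussian (v : ℝ≥0) :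
    IsProbabilityMeasure (complexGaussian v) :=
  Measure.isProbabilityMeasure_map
    Complex.measurableEquivRealProd.symm.measurable.aemeasurable

/-- Joint law of the Rayleigh fading channels `(h_SR, H_RR, h_RD)`: all entries are independent,
those of `h_SR` (an `MR × 1` column) and of `h_RD` (a `1 × MT` row) are `CN(0, 1)`, those of the
loopback channel `H_RR` (`MR × MT`) are `CN(0, v)`. -/
def rayleighLaw (MR MT : ℕ) (v : ℝ≥0) :
    Measure ((Fin MR → ℂ) × (Fin MR → Fin MT → ℂ) × (Fin MT → ℂ)) :=
  (Measure.pi fun _ => complexGaussian 1).prod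
    ((Measure.pi fun _ => Measure.pi fun _ => complexGaussian v).prod
      (Measure.pi fun _ => complexGaussian 1))

/-- The Euclidean norm of a complex vector. -/
def vecNorm {n : ℕ} (x : Fin n → ℂ) : ℝ := ‖WithLp.toLp 2 x‖

/-- `κ = η α / (1 - α)`, for energy conversion efficiency `η` and harvesting time fraction `α`. -/
def kappa (η α : ℝ) : ℝ := η * α / (1 - α)

/-- End-to-end SINR of the decode-and-forward full-duplex relay whose transmit power is the
harvested power: source power `PS`, distances `d₁`, `d₂`, path loss exponent `τ`, channels
`hSR`, `H`, `hRD`, receive combiner `wr` (a row) and transmit beamformer `wt` (a column). -/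
def sinr {MR MT : ℕ} (κ τ d₁ d₂ PS : ℝ) (hSR : Fin MR → ℂ) (H : Matrix (Fin MR) (Fin MT) ℂ)
    (hRD : Fin MT → ℂ) (wr : Fin MR → ℂ) (wt : Fin MT → ℂ) : ℝ :=
  min
    (PS * ‖wr ⬝ᵥ hSR‖ ^ 2 /
      (κ * PS * vecNorm hSR ^ 2 * ‖wr ⬝ᵥ (H *ᵥ wt)‖ ^ 2 + d₁ ^ τ))
    (κ * PS / (d₁ ^ τ * d₂ ^ τ) * vecNorm hSR ^ 2 * ‖hRD ⬝ᵥ wt‖ ^ 2)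

/-- Maximum ratio transmission: `w_t = h_RD† / ‖h_RD‖`. -/
def mrtBeamformer {MT : ℕ} (hRD : Fin MT → ℂ) : Fin MT → ℂ :=
  ((vecNorm hRD)⁻¹ : ℂ) • star hRD

/-- `D = I - H h_RD† h_RD H† / ‖H h_RD†‖²`, the orthogonal projection onto the complement of the
received loopback direction `H h_RD†`. -/
def rzfProjection {MR MT : ℕ} (H : Matrix (Fin MR) (Fin MT) ℂ) (hRD : Fin MT → ℂ) :
    Matrix (Fin MR) (Fin MR) ℂ :=
  1 - ((vecNorm (H *ᵥ star hRD) ^ 2)⁻¹ : ℂ) •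
    Matrix.vecMulVec (H *ᵥ star hRD) (star (H *ᵥ star hRD))

/-- The receive zero-forcing combiner, the row vector `w_r = (D h_SR)† / ‖D h_SR‖`. -/
def rzfCombiner {MR MT : ℕ} (hSR : Fin MR → ℂ) (H : Matrix (Fin MR) (Fin MT) ℂ)
    (hRD : Fin MT → ℂ) : Fin MR → ℂ :=
  ((vecNorm (rzfProjection H hRD *ᵥ hSR))⁻¹ : ℂ) • star (rzfProjection H hRD *ᵥ hSR)

/-- End-to-end SINR with receive zero-forcing and maximum ratio transmission. -/
def rzfSinr {MR MT : ℕ} (κ τ d₁ d₂ PS : ℝ) (hSR : Fin MR → ℂ) (H : Matrix (Fin MR) (Fin MT) ℂ)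
    (hRD : Fin MT → ℂ) : ℝ :=
  sinr κ τ d₁ d₂ PS hSR H hRD (rzfCombiner hSR H hRD) (mrtBeamformer hRD)

/-- Outage probability: the probability that the random SINR `γ` falls below the threshold `z`. -/
def outageProb {Ω : Type*} [MeasurableSpace Ω] (P : Measure Ω) (γ : Ω → ℝ) (z : ℝ) : ℝ :=
  P.real {ω | γ ω < z}

/-- An outage probability, as a function of the SNR, has diversity order `d` if
`- log p(ρ) / log ρ → d` as `ρ → ∞`. -/
def HasDiversityOrder (p : ℝ → ℝ) (d : ℝ) : Prop :=
  Tendsto (fun ρ => -Real.log (p ρ) / Real.log ρ) atTop (𝓝 d)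

end FDRelay

end

namespace FDRelay

/-! Zero-forcing makes the combiner orthogonal to the loopback direction `H h_RD†`, so the
interference disappears. Put `X = ‖D h_SR‖²`, `S = ‖h_SR‖²`, `W = ‖h_RD‖²`, `ε = d₁^τ z / ρ₁` and `c
= d₂^τ / κ`. Outage is then the event `X < ε` or `S W < c ε` (`rzfSinr_lt_iff`), and `ε → 0`.

By rotation invariance of Gaussian vectors, `D` acts on `h_SR` like the deletion of one complex
coordinate. So `X` is Gamma of shape `a = MR - 1` for almost every value of the other channels, and
is therefore independent of `W`, which is Gamma of shape `b = MT` (`hasLaw_rzf_gain`). Likewise `S`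
is Gamma of shape `a + 1`, independent of `W`. `X` and `S` are dependent, but their joint law is
never needed.

The rest is inclusion-exclusion (`tendsto_measureReal_union_div_pow`). The first hop fails with
probability `~ ε^a / a!`. Conditioning on `S`, the second fails with probability `~ (c ε)^b / b! *
E[S^(-b)]`, where the moment `Γ(a + 1 - b) / Γ(a + 1)` is finite exactly when `b ≤ a`; for `b > a` a
fractional moment still gives `o(ε^a)`. Joint failure has probability `o(ε^a)`. The smaller of `a`
and `b` decides, and both hops contribute when they agree. -/

/-! ### Densities of complex Gaussian vectors -/

lemma lintegral_pi_prod_eq_prod_lintegral {X : Type*} [MeasurableSpace X] {n : ℕ}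
    (μ : Measure X) [SigmaFinite μ] (g : Fin n → X → ENNReal) (hg : ∀ i, Measurable (g i)) :
    ∫⁻ x, ∏ i, g i (x i) ∂(Measure.pi fun _ : Fin n => μ) = ∏ i, ∫⁻ y, g i y ∂μ := by
  induction n with
  | zero => simp
  | succ n ih =>
    have h := (measurePreserving_piFinSuccAbove (fun _ : Fin (n + 1) => μ) 0).symm
    rw [← h.lintegral_comp_emb (MeasurableEquiv.measurableEmbedding _)]
    simp only [Fin.prod_univ_succ]
    rw [← ih (fun i => g i.succ) (fun i => hg _)]
    refine Eq.trans ?_ (lintegral_prod_mul (hg 0).aemeasurable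
      (g := fun x : Fin n → X => ∏ i : Fin n, g i.succ (x i))
      (Finset.measurable_fun_prod _ fun i _ => (hg _).comp (measurable_pi_apply i)).aemeasurable)
    rfl

lemma pi_withDensity {X : Type*} [MeasurableSpace X] {n : ℕ}
    (μ : Measure X) [SigmaFinite μ] (f : X → ENNReal) (hf : Measurable f)
    [SigmaFinite (μ.withDensity f)] :
    (Measure.pi fun _ : Fin n => μ.withDensity f) =
      (Measure.pi fun _ : Fin n => μ).withDensity fun x => ∏ i, f (x i) := by
  refine Measure.pi_eq fun s hs => ?_
  rw [withDensity_apply _ (MeasurableSet.univ_pi hs), ← lintegral_indicator (MeasurableSet.univ_pi hs)]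
  have : (Set.univ.pi s).indicator (fun x : Fin n → X => ∏ i, f (x i)) =
      fun x => ∏ i, (s i).indicator f (x i) := by
    funext x
    by_cases hx : x ∈ Set.univ.pi s
    · rw [Set.indicator_of_mem hx]
      exact Finset.prod_congr rfl fun i _ => (Set.indicator_of_mem (hx i trivial) f).symm
    · rw [Set.indicator_of_notMem hx]
      simp only [Set.mem_pi, Set.mem_univ, true_implies, not_forall] at hx
      obtain ⟨i, hi⟩ := hx
      exact (Finset.prod_eq_zero (Finset.mem_univ i) (Set.indicator_of_notMem hi f)).symm
  rw [this, lintegral_pi_prod_eq_prod_lintegral μ _ fun i => hf.indicator (hs i)]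
  refine Finset.prod_congr rfl fun i _ => ?_
  rw [lintegral_indicator (hs i), withDensity_apply _ (hs i)]

/-- The two real densities of variance `v / 2` multiply to a function of `re² + im²` alone; this
radial form is the source of rotation invariance. -/
lemma complexGaussian_eq_withDensity {v : ℝ≥0} (hv : v ≠ 0) :
    complexGaussian v = volume.withDensity fun z : ℂ =>
      ENNReal.ofReal ((Real.pi * v)⁻¹ * Real.exp (-‖z‖ ^ 2 / v)) := by
  have hv2 : v / 2 ≠ 0 := by simpa using hv
  have hp : (0 : ℝ) < v := by exact_mod_cast pos_iff_ne_zero.2 hv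
  rw [complexGaussian, gaussianReal_of_var_ne_zero _ hv2,
    prod_withDensity (measurable_gaussianPDF _ _) (measurable_gaussianPDF _ _)]
  have h := Complex.volume_preserving_equiv_real_prod.symm
  ext s hs
  rw [Measure.map_apply (MeasurableEquiv.measurable _) hs,
    withDensity_apply _ ((MeasurableEquiv.measurable _) hs), withDensity_apply _ hs,
    ← h.setLIntegral_comp_preimage_emb (MeasurableEquiv.measurableEmbedding _)]
  refine lintegral_congr fun p => ?_
  rw [gaussianPDF, gaussianPDF, ← ENNReal.ofReal_mul (gaussianPDFReal_nonneg _ _ _)]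
  congr 1
  rw [gaussianPDFReal, gaussianPDFReal, mul_mul_mul_comm, ← Real.exp_add, ← mul_inv,
    Real.mul_self_sqrt (by positivity)]
  have : ‖Complex.measurableEquivRealProd.symm p‖ ^ 2 = p.1 ^ 2 + p.2 ^ 2 := by
    rw [Complex.sq_norm, Complex.normSq_apply]
    simp [Complex.measurableEquivRealProd, sq]
  rw [this]
  push_cast
  congr 2
  · ring
  · field_simp
    ring

lemma vecNorm_sq {n : ℕ} (x : Fin n → ℂ) : vecNorm x ^ 2 = ∑ i, ‖x i‖ ^ 2 := by
  rw [vecNorm, EuclideanSpace.norm_sq_eq]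

lemma pi_complexGaussian_eq_withDensity {n : ℕ} {v : ℝ≥0} (hv : v ≠ 0) :
    (Measure.pi fun _ : Fin n => complexGaussian v) = volume.withDensity fun x : Fin n → ℂ =>
      ENNReal.ofReal ((Real.pi * v)⁻¹ ^ n * Real.exp (-vecNorm x ^ 2 / v)) := by
  have h := complexGaussian_eq_withDensity hv
  have : SigmaFinite (volume.withDensity fun z : ℂ =>
      ENNReal.ofReal ((Real.pi * v)⁻¹ * Real.exp (-‖z‖ ^ 2 / v))) := h ▸ inferInstance
  simp_rw [h]
  rw [pi_withDensity _ _ (by fun_prop), ← volume_pi]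
  congr 1
  funext x
  rw [← ENNReal.ofReal_prod_of_nonneg fun i _ => by positivity, Finset.prod_mul_distrib,
    ← Real.exp_sum, vecNorm_sq]
  simp [← Finset.sum_div]

lemma pi_complexGaussian_absolutelyContinuous {n : ℕ} {v : ℝ≥0} (hv : v ≠ 0) :
    (Measure.pi fun _ : Fin n => complexGaussian v) ≪ volume := by
  rw [pi_complexGaussian_eq_withDensity hv]
  exact withDensity_absolutelyContinuous _ _

/-! ### Rotation invariance and Gamma laws of squared norms -/

/-- Lebesgue measure transported to Euclidean space is an additive Haar measure, hence a multiple of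
`volume`. The constant is left unspecified, since total mass one determines it later. -/
lemma exists_map_toLp_pi_complexGaussian (n : ℕ) : ∃ C : ℝ, 0 ≤ C ∧
    (Measure.pi fun _ : Fin n => complexGaussian 1).map (WithLp.toLp 2) =
      (volume : Measure (EuclideanSpace ℂ (Fin n))).withDensity fun x =>
        ENNReal.ofReal (C * Real.exp (-‖x‖ ^ 2)) := by
  let e := (PiLp.continuousLinearEquiv 2 ℝ fun _ : Fin n => ℂ).symm
  have hm : Measurable (WithLp.toLp 2 : (Fin n → ℂ) → EuclideanSpace ℂ (Fin n)) :=
    e.continuous.measurable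
  have : ((volume : Measure (Fin n → ℂ)).map e).IsAddHaarMeasure :=
    e.isAddHaarMeasure_map _
  obtain ⟨c, hc⟩ : ∃ c : ℝ≥0, (volume : Measure (Fin n → ℂ)).map e = c • volume :=
    ⟨_, Measure.isAddLeftInvariant_eq_smul _ _⟩
  refine ⟨c * (Real.pi)⁻¹ ^ n, by positivity, ?_⟩
  ext s hs
  have hd : Measurable fun x : EuclideanSpace ℂ (Fin n) =>
    ENNReal.ofReal (Real.pi⁻¹ ^ n * Real.exp (-‖x‖ ^ 2)) := by fun_prop
  rw [Measure.map_apply hm hs, pi_complexGaussian_eq_withDensity one_ne_zero,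
    withDensity_apply _ (hm hs), withDensity_apply _ hs]
  have h1 := setLIntegral_map (μ := (volume : Measure (Fin n → ℂ))) hs hd e.continuous.measurable
  rw [hc, Measure.restrict_smul, lintegral_smul_measure, ENNReal.smul_def, smul_eq_mul, ← lintegral_const_mul _ hd] at h1
  have h2 : ∀ x : EuclideanSpace ℂ (Fin n),
      ENNReal.ofReal (c * Real.pi⁻¹ ^ n * Real.exp (-‖x‖ ^ 2)) =
        c * ENNReal.ofReal (Real.pi⁻¹ ^ n * Real.exp (-‖x‖ ^ 2)) := fun x => by
    rw [mul_assoc, ENNReal.ofReal_mul c.coe_nonneg, ENNReal.ofReal_coe_nnreal]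
  simp_rw [h2]
  rw [h1]
  simp [vecNorm, e]
  rfl

/-- The law of a standard circularly symmetric Gaussian vector is rotation invariant. -/
lemma map_isometry_pi_complexGaussian {n : ℕ}
    (T : EuclideanSpace ℂ (Fin n) ≃ₗᵢ[ℂ] EuclideanSpace ℂ (Fin n)) :
    ((Measure.pi fun _ : Fin n => complexGaussian 1).map (WithLp.toLp 2)).map T =
      (Measure.pi fun _ : Fin n => complexGaussian 1).map (WithLp.toLp 2) := by
  obtain ⟨C, -, hC⟩ := exists_map_toLp_pi_complexGaussian n
  rw [hC]
  -- Seen as a real isometry, `T` preserves volume, and the density depends only on the norm.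
  let T' : EuclideanSpace ℂ (Fin n) ≃ₗᵢ[ℝ] EuclideanSpace ℂ (Fin n) :=
    { T.toLinearEquiv.restrictScalars ℝ with norm_map' := T.norm_map }
  have hT : MeasurePreserving T' := T'.measurePreserving
  ext s hs
  change Measure.map T' _ s = _
  rw [Measure.map_apply hT.measurable hs, withDensity_apply _ (hT.measurable hs),
    withDensity_apply _ hs, ← hT.setLIntegral_comp_preimage hs (by fun_prop)]
  simp

/-- The squared norm of a standard circularly symmetric Gaussian vector is Gamma distributed. -/
lemma hasLaw_vecNorm_sq {n : ℕ} (hn : 1 ≤ n) :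
    HasLaw (fun x : Fin n → ℂ => vecNorm x ^ 2) (gammaMeasure n 1)
      (Measure.pi fun _ : Fin n => complexGaussian 1) := by
  have hn0 : (0 : ℝ) < n := by exact_mod_cast hn
  have : Nonempty (Fin n) := ⟨⟨0, hn⟩⟩
  let E := EuclideanSpace ℂ (Fin n)
  have hm : Measurable (WithLp.toLp 2 : (Fin n → ℂ) → E) :=
    (PiLp.continuousLinearEquiv 2 ℝ fun _ : Fin n => ℂ).symm.continuous.measurable
  have hN : Measurable fun x : Fin n → ℂ => vecNorm x ^ 2 := (hm.norm).pow_const 2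
  refine ⟨hN.aemeasurable, ?_⟩
  set μ := Measure.pi fun _ : Fin n => complexGaussian 1 with hμ
  have := isProbabilityMeasure_gammaMeasure hn0 one_pos
  have : IsProbabilityMeasure (μ.map fun x : Fin n → ℂ => vecNorm x ^ 2) :=
    Measure.isProbabilityMeasure_map hN.aemeasurable
  obtain ⟨C, hC0, hC⟩ := exists_map_toLp_pi_complexGaussian n
  have hdim : Module.finrank ℝ E = 2 * n := by
    have := (PiLp.continuousLinearEquiv 2 ℝ fun _ : Fin n => ℂ).toLinearEquiv.finrank_eq
    rw [this, Module.finrank_pi_fintype]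
    simp [mul_comm]
  obtain ⟨K, hK⟩ : ∃ K : ℝ, ∀ s : Set ℝ, MeasurableSet s →
      (μ.map fun x : Fin n → ℂ => vecNorm x ^ 2).real s =
        K * ∫ t in Set.Ioi (0 : ℝ), s.indicator 1 t * (Real.exp (-t) * t ^ ((n : ℝ) - 1)) := by
    -- Polar coordinates in real dimension `2 * n` give the dimension times the volume of the unit
    -- ball; `2⁻¹` comes from substituting `t = r²`.
    refine ⟨C * (2 * n) * (volume : Measure E).real (Metric.ball 0 1) * 2⁻¹, fun s hs => ?_⟩
    have h0 : (μ.map fun x : Fin n → ℂ => vecNorm x ^ 2) = (μ.map (WithLp.toLp 2)).map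
        fun x : E => ‖x‖ ^ 2 := by
      rw [Measure.map_map (by fun_prop) hm]; rfl
    rw [h0, map_measureReal_apply (by fun_prop) hs, hμ, hC, ← integral_indicator_one
      ((by fun_prop : Measurable fun x : E => ‖x‖ ^ 2) hs),
      integral_withDensity_eq_integral_toReal_smul (by fun_prop) (by simp)]
    have h1 := integral_fun_norm_addHaar (volume : Measure E) fun r : ℝ =>
      C * Real.exp (-r ^ 2) * s.indicator 1 (r ^ 2)
    have h2 : ∀ x : E, (ENNReal.ofReal (C * Real.exp (-‖x‖ ^ 2))).toReal •
        ((fun x : E => ‖x‖ ^ 2) ⁻¹' s).indicator (1 : E → ℝ) x =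
        C * Real.exp (-‖x‖ ^ 2) * s.indicator 1 (‖x‖ ^ 2) := fun x => by
      rw [ENNReal.toReal_ofReal (by positivity), smul_eq_mul]; rfl
    simp_rw [h2]
    rw [h1, hdim, ← integral_comp_rpow_Ioi_of_pos (p := 2)
      (g := fun t => s.indicator (1 : ℝ → ℝ) t * (Real.exp (-t) * t ^ ((n : ℝ) - 1))) two_pos]
    simp only [nsmul_eq_mul, smul_eq_mul]
    rw [← integral_const_mul, ← integral_const_mul, ← integral_const_mul]
    refine setIntegral_congr_fun measurableSet_Ioi fun r (hr : 0 < r) => ?_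
    have h3 : (r ^ (2 : ℝ)) ^ ((n : ℝ) - 1) * r = r ^ (2 * n - 1) := by
      rw [← Real.rpow_mul hr.le, ← Real.rpow_add_one hr.ne', ← Real.rpow_natCast,
        Nat.cast_sub (by omega)]
      push_cast; ring_nf
    simp only [← h3]
    norm_num
    ring
  -- Total mass one fixes `K`, so no ball volume has to be evaluated.
  have hG : K * Real.Gamma n = 1 := by
    have := hK Set.univ MeasurableSet.univ
    rw [Real.Gamma_eq_integral hn0]
    simpa using this.symm
  ext s hs
  rw [← measureReal_eq_measureReal_iff, hK s hs, gammaMeasure, measureReal_def,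
    withDensity_apply _ hs]
  have h1 : (∫⁻ t in s, gammaPDF n 1 t).toReal = ∫ t in s, gammaPDFReal n 1 t :=
    (integral_eq_lintegral_of_nonneg_ae
      (Eventually.of_forall fun t => gammaPDFReal_nonneg hn0 one_pos t)
      (measurable_gammaPDFReal _ _).aestronglyMeasurable).symm
  rw [h1, ← integral_const_mul, ← integral_indicator hs, ← integral_indicator measurableSet_Ioi]
  refine integral_congr_ae ?_
  filter_upwards [Measure.ae_ne volume (0 : ℝ)] with t ht
  have hK' : K = 1 / Real.Gamma n := eq_one_div_of_mul_eq_one_left hG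
  rcases lt_or_gt_of_ne ht with h | h
  · rw [Set.indicator_of_notMem (by simpa using h.le)]
    by_cases hts : t ∈ s <;> simp [hts, gammaPDFReal, h.not_ge]
  · rw [Set.indicator_of_mem (by simpa using h)]
    by_cases hts : t ∈ s
    · simp [hts, gammaPDFReal, h.le, hK']
      ring
    · simp [hts]

@[fun_prop]
lemma measurable_vecNorm {n : ℕ} : Measurable (vecNorm : (Fin n → ℂ) → ℝ) :=
  (PiLp.continuousLinearEquiv 2 ℝ fun _ : Fin n => ℂ).symm.continuous.measurable.norm

lemma vecNorm_nonneg {n : ℕ} (x : Fin n → ℂ) : 0 ≤ vecNorm x := norm_nonneg _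

lemma vecNorm_eq_zero {n : ℕ} {x : Fin n → ℂ} : vecNorm x = 0 ↔ x = 0 := by
  rw [vecNorm, norm_eq_zero, WithLp.toLp_eq_zero]

/-- Removing one coordinate of a standard Gaussian vector lowers the Gamma shape by one. -/
lemma hasLaw_vecNorm_tail_sq {n : ℕ} (hn : 1 ≤ n) :
    HasLaw (fun x : Fin (n + 1) → ℂ => vecNorm (fun i => x i.succ) ^ 2) (gammaMeasure n 1)
      (Measure.pi fun _ : Fin (n + 1) => complexGaussian 1) := by
  have h := measurePreserving_piFinSuccAbove (fun _ : Fin (n + 1) => complexGaussian 1) 0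
  have h2 := (measurePreserving_snd (μ := complexGaussian 1)
    (ν := Measure.pi fun _ : Fin n => complexGaussian 1)).comp h
  exact (hasLaw_vecNorm_sq hn).comp h2.hasLaw

/-- The squared norm of the component of a standard Gaussian vector orthogonal to `u ≠ 0`. -/
lemma hasLaw_vecNorm_orthogonal_sq {n : ℕ} (hn : 1 ≤ n) {u : Fin (n + 1) → ℂ} (hu : u ≠ 0) :
    HasLaw (fun x : Fin (n + 1) → ℂ => vecNorm x ^ 2 - ‖star u ⬝ᵥ x‖ ^ 2 / vecNorm u ^ 2)
      (gammaMeasure n 1) (Measure.pi fun _ : Fin (n + 1) => complexGaussian 1) := by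
  have hu0 : vecNorm u ≠ 0 := fun h => hu (vecNorm_eq_zero.1 h)
  let E := EuclideanSpace ℂ (Fin (n + 1))
  let w : E := ((vecNorm u)⁻¹ : ℂ) • WithLp.toLp 2 u
  have hw : ‖w‖ = 1 := by
    rw [norm_smul, norm_inv, Complex.norm_real, Real.norm_of_nonneg (vecNorm_nonneg u)]
    exact inv_mul_cancel₀ hu0
  -- In an orthonormal basis starting with `u / ‖u‖`, the zeroth coordinate is the component along
  -- `u` and the tail is the orthogonal component; the coordinate map preserves the Gaussian law.
  obtain ⟨b, hb⟩ := Orthonormal.exists_orthonormalBasis_extension_of_card_eq (𝕜 := ℂ) (E := E)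
    (ι := Fin (n + 1)) (by simp [E]) (v := fun _ => w) (s := {0})
    ⟨fun i => hw, fun i j hij => (hij (Subsingleton.elim i j)).elim⟩
  have hb0 : b 0 = w := hb 0 rfl
  have hm : Measurable (WithLp.toLp 2 : (Fin (n + 1) → ℂ) → E) :=
    (PiLp.continuousLinearEquiv 2 ℝ fun _ : Fin (n + 1) => ℂ).symm.continuous.measurable
  have hm' : Measurable (WithLp.ofLp : E → (Fin (n + 1) → ℂ)) :=
    (PiLp.continuousLinearEquiv 2 ℝ fun _ : Fin (n + 1) => ℂ).continuous.measurable
  have hT : Measurable b.repr := b.repr.continuous.measurable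
  have hR : HasLaw (fun x : Fin (n + 1) → ℂ => (b.repr (WithLp.toLp 2 x)).ofLp)
      (Measure.pi fun _ : Fin (n + 1) => complexGaussian 1)
      (Measure.pi fun _ : Fin (n + 1) => complexGaussian 1) := by
    refine ⟨(hm'.comp (hT.comp hm)).aemeasurable, ?_⟩
    have h := congrArg (Measure.map WithLp.ofLp) (map_isometry_pi_complexGaussian b.repr)
    rw [Measure.map_map hT hm, Measure.map_map hm' (hT.comp hm), Measure.map_map hm' hm] at h
    exact h.trans Measure.map_id
  have h := (hasLaw_vecNorm_tail_sq hn).fun_comp hR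
  refine h.congr (Eventually.of_forall fun x => ?_)
  have h1 : vecNorm x ^ 2 = ‖b.repr (WithLp.toLp 2 x) 0‖ ^ 2 +
      vecNorm (fun i : Fin n => (b.repr (WithLp.toLp 2 x)).ofLp i.succ) ^ 2 := by
    rw [vecNorm_sq (fun i : Fin n => (b.repr (WithLp.toLp 2 x)).ofLp i.succ),
      ← Fin.sum_univ_succ (fun i => ‖(b.repr (WithLp.toLp 2 x)).ofLp i‖ ^ 2),
      ← EuclideanSpace.norm_sq_eq, LinearIsometryEquiv.norm_map, vecNorm]
  have h2 : ‖b.repr (WithLp.toLp 2 x) 0‖ ^ 2 = ‖star u ⬝ᵥ x‖ ^ 2 / vecNorm u ^ 2 := by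
    rw [b.repr_apply_apply, hb0, inner_smul_left, norm_mul, EuclideanSpace.inner_eq_star_dotProduct,
      dotProduct_comm]
    simp [mul_pow, div_eq_inv_mul]
  simp only [h1, h2]
  ring

/-! ### Almost sure nondegeneracy of the channels -/

open scoped ComplexOrder in
/-- A proper complex hyperplane has zero probability under a nondegenerate Gaussian law. -/
lemma ae_dotProduct_ne_zero {n : ℕ} {v : ℝ≥0} (hv : v ≠ 0) {w : Fin n → ℂ} (hw : w ≠ 0) :
    ∀ᵐ x ∂(Measure.pi fun _ : Fin n => complexGaussian v), x ⬝ᵥ w ≠ 0 := by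
  refine (pi_complexGaussian_absolutelyContinuous hv).ae_le ?_
  let f : (Fin n → ℂ) →ₗ[ℝ] ℂ :=
    { toFun := fun x => x ⬝ᵥ w
      map_add' := fun x y => add_dotProduct x y w
      map_smul' := fun c x => smul_dotProduct c x w }
  have h := Measure.addHaar_submodule (volume : Measure (Fin n → ℂ)) (LinearMap.ker f) (by
    intro htop
    apply hw
    have h0 : f (star w) = 0 := by
      have : star w ∈ LinearMap.ker f := htop ▸ Submodule.mem_top
      exact this
    exact dotProduct_star_self_eq_zero.1 h0)
  exact measure_eq_zero_iff_ae_notMem.1 h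

lemma ae_ne_zero_pi_complexGaussian {n : ℕ} (hn : 1 ≤ n) {v : ℝ≥0} (hv : v ≠ 0) :
    ∀ᵐ x ∂(Measure.pi fun _ : Fin n => complexGaussian v), x ≠ 0 := by
  filter_upwards [ae_dotProduct_ne_zero hv (w := fun _ : Fin n => (1 : ℂ))
    (fun h => one_ne_zero (congrFun h ⟨0, hn⟩))] with x hx h
  simp [h] at hx

/-- The received loopback direction `H w` is almost surely nonzero for `w ≠ 0`. -/
lemma ae_mulVec_ne_zero {m n : ℕ} (hm : 1 ≤ m) {v : ℝ≥0} (hv : v ≠ 0) {w : Fin n → ℂ}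
    (hw : w ≠ 0) :
    ∀ᵐ H ∂(Measure.pi fun _ : Fin m => Measure.pi fun _ : Fin n => complexGaussian v),
      Matrix.of H *ᵥ w ≠ 0 := by
  have h := (measurePreserving_eval (fun _ : Fin m => Measure.pi fun _ : Fin n => complexGaussian v)
    ⟨0, hm⟩).quasiMeasurePreserving.ae (ae_dotProduct_ne_zero hv hw)
  filter_upwards [h] with H hH h0
  exact hH (congrFun h0 ⟨0, hm⟩)

/-! ### Gamma distribution: negative moments and behaviour at the origin -/

lemma isProbabilityMeasure_gammaMeasure_natCast {n : ℕ} (hn : 1 ≤ n) :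
    IsProbabilityMeasure (gammaMeasure n 1) :=
  isProbabilityMeasure_gammaMeasure (by exact_mod_cast hn) one_pos

lemma ae_pos_gammaMeasure {a : ℝ} : ∀ᵐ x ∂(gammaMeasure a 1), 0 < x := by
  have h : gammaMeasure a 1 (Set.Iic 0) = 0 := by
    rw [gammaMeasure, withDensity_apply _ measurableSet_Iic, ← lintegral_gammaPDF_of_nonpos le_rfl]
    exact setLIntegral_congr Iio_ae_eq_Iic.symm
  filter_upwards [measure_eq_zero_iff_ae_notMem.1 h] with x hx
  simpa using hx

lemma measurable_gammaPDF (a r : ℝ) : Measurable (gammaPDF a r) :=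
  (measurable_gammaPDFReal a r).ennreal_ofReal

lemma integral_gammaMeasure {a : ℝ} (ha : 0 < a) (f : ℝ → ℝ) :
    ∫ x, f x ∂(gammaMeasure a 1) =
      ∫ x in Set.Ioi (0 : ℝ), (Real.Gamma a)⁻¹ * (x ^ (a - 1) * Real.exp (-x)) * f x := by
  rw [gammaMeasure, integral_withDensity_eq_integral_toReal_smul
    (measurable_gammaPDF a 1) (by simp [gammaPDF]),
    ← integral_indicator measurableSet_Ioi]
  refine integral_congr_ae ?_
  filter_upwards [Measure.ae_ne volume (0 : ℝ)] with x hx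
  rw [gammaPDF, ENNReal.toReal_ofReal (gammaPDFReal_nonneg ha one_pos x), smul_eq_mul]
  rcases lt_or_gt_of_ne hx with h | h
  · rw [Set.indicator_of_notMem (by simpa using h.le), gammaPDFReal, if_neg h.not_ge, zero_mul]
  · rw [Set.indicator_of_mem (by simpa using h), gammaPDFReal, if_pos h.le]
    simp [mul_assoc]

lemma integrable_gammaMeasure_iff {a : ℝ} (ha : 0 < a) (f : ℝ → ℝ) :
    Integrable f (gammaMeasure a 1) ↔ IntegrableOn
      (fun x => (Real.Gamma a)⁻¹ * (x ^ (a - 1) * Real.exp (-x)) * f x) (Set.Ioi 0) := by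
  rw [gammaMeasure, integrable_withDensity_iff_integrable_smul'
    (measurable_gammaPDF a 1) (by simp [gammaPDF]),
    ← integrable_indicator_iff measurableSet_Ioi]
  refine integrable_congr ?_
  filter_upwards [Measure.ae_ne volume (0 : ℝ)] with x hx
  rw [gammaPDF, ENNReal.toReal_ofReal (gammaPDFReal_nonneg ha one_pos x), smul_eq_mul]
  rcases lt_or_gt_of_ne hx with h | h
  · rw [Set.indicator_of_notMem (by simpa using h.le), gammaPDFReal, if_neg h.not_ge, zero_mul]
  · rw [Set.indicator_of_mem (by simpa using h), gammaPDFReal, if_pos h.le]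
    simp [mul_assoc]

lemma gamma_density_mul_rpow_neg {a s x : ℝ} (hx : 0 < x) :
    (Real.Gamma a)⁻¹ * (x ^ (a - 1) * Real.exp (-x)) * x ^ (-s) =
      (Real.Gamma a)⁻¹ * (Real.exp (-x) * x ^ (a - s - 1)) := by
  rw [show a - s - 1 = a - 1 + -s by ring, Real.rpow_add hx]
  ring

/-- Negative moments of the Gamma distribution. -/
lemma integrable_rpow_neg_gammaMeasure {a s : ℝ} (ha : 0 < a) (hs : s < a) :
    Integrable (fun x => x ^ (-s)) (gammaMeasure a 1) := by
  rw [integrable_gammaMeasure_iff ha]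
  refine IntegrableOn.congr_fun ((Real.GammaIntegral_convergent (sub_pos.2 hs)).const_mul _)
    (fun x hx => (gamma_density_mul_rpow_neg hx).symm) measurableSet_Ioi

lemma integral_rpow_neg_gammaMeasure {a s : ℝ} (ha : 0 < a) (hs : s < a) :
    ∫ x, x ^ (-s) ∂(gammaMeasure a 1) = Real.Gamma (a - s) / Real.Gamma a := by
  rw [integral_gammaMeasure ha, setIntegral_congr_fun measurableSet_Ioi
    (fun x hx => gamma_density_mul_rpow_neg hx), integral_const_mul,
    ← Real.Gamma_eq_integral (sub_pos.2 hs)]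
  ring

lemma measureReal_gammaMeasure_Iio {n : ℕ} (hn : 1 ≤ n) {t : ℝ} (ht : 0 ≤ t) :
    (gammaMeasure n 1).real (Set.Iio t) =
      ∫ x in (0 : ℝ)..t, (Real.Gamma n)⁻¹ * (x ^ (n - 1) * Real.exp (-x)) := by
  rw [← integral_indicator_one measurableSet_Iio, integral_gammaMeasure (by exact_mod_cast hn),
    intervalIntegral.integral_of_le ht, integral_Ioc_eq_integral_Ioo, ← Set.Ioi_inter_Iio,
    ← setIntegral_indicator measurableSet_Iio]
  refine setIntegral_congr_fun measurableSet_Ioi fun x (hx : 0 < x) => ?_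
  by_cases h : x ∈ Set.Iio t
  · simp only [Set.indicator_of_mem h, Pi.one_apply, mul_one]
    rw [← Real.rpow_natCast, Nat.cast_sub hn, Nat.cast_one]
  · simp [Set.indicator_of_notMem h]

lemma integral_pow_div_Gamma {n : ℕ} (hn : 1 ≤ n) (t k : ℝ) :
    ∫ x in (0 : ℝ)..t, (Real.Gamma n)⁻¹ * (x ^ (n - 1) * k) = k * (t ^ n / n.factorial) := by
  obtain ⟨m, rfl⟩ : ∃ m, n = m + 1 := ⟨n - 1, by omega⟩
  simp only [intervalIntegral.integral_const_mul, intervalIntegral.integral_mul_const,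
    Nat.add_sub_cancel, integral_pow]
  push_cast [Real.Gamma_nat_eq_factorial, Nat.factorial_succ]
  have := Nat.factorial_pos m
  field_simp
  simp

/-- The density is bounded using `exp (-x) ≤ 1`. The bound holds for every `t ≥ 0`, so it also
provides the dominating function for products. -/
lemma measureReal_gammaMeasure_Iio_le {n : ℕ} (hn : 1 ≤ n) {t : ℝ} (ht : 0 ≤ t) :
    (gammaMeasure n 1).real (Set.Iio t) ≤ t ^ n / n.factorial := by
  rw [measureReal_gammaMeasure_Iio hn ht, ← one_mul (t ^ n / _), ← integral_pow_div_Gamma hn]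
  refine intervalIntegral.integral_mono_on ht
    (Continuous.intervalIntegrable (by fun_prop) _ _)
    (Continuous.intervalIntegrable (by fun_prop) _ _) fun x hx => ?_
  have := Real.Gamma_nonneg_of_nonneg n.cast_nonneg
  have := hx.1
  gcongr
  simpa using hx.1

lemma le_measureReal_gammaMeasure_Iio {n : ℕ} (hn : 1 ≤ n) {t : ℝ} (ht : 0 ≤ t) :
    Real.exp (-t) * (t ^ n / n.factorial) ≤ (gammaMeasure n 1).real (Set.Iio t) := by
  rw [measureReal_gammaMeasure_Iio hn ht, ← integral_pow_div_Gamma hn]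
  refine intervalIntegral.integral_mono_on ht
    (Continuous.intervalIntegrable (by fun_prop) _ _)
    (Continuous.intervalIntegrable (by fun_prop) _ _) fun x hx => ?_
  have := Real.Gamma_nonneg_of_nonneg n.cast_nonneg
  have := hx.1
  have := hx.2
  gcongr

/-- Behaviour at the origin of the distribution function of the Gamma distribution. -/
lemma tendsto_measureReal_gammaMeasure_Iio {n : ℕ} (hn : 1 ≤ n) :
    Tendsto (fun t => (gammaMeasure n 1).real (Set.Iio t) / t ^ n) (𝓝[>] 0)
      (𝓝 (1 / n.factorial)) := by
  have h : Tendsto (fun t : ℝ => Real.exp (-t) * (1 / n.factorial)) (𝓝[>] 0)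
      (𝓝 (1 / n.factorial)) := by
    have : Continuous fun t : ℝ => Real.exp (-t) * (1 / n.factorial) := by fun_prop
    simpa using (this.tendsto 0).mono_left nhdsWithin_le_nhds
  refine tendsto_of_tendsto_of_tendsto_of_le_of_le' h tendsto_const_nhds ?_ ?_
  · filter_upwards [self_mem_nhdsWithin] with t (ht : 0 < t)
    rw [le_div_iff₀ (by positivity)]
    exact le_of_eq_of_le (by ring) (le_measureReal_gammaMeasure_Iio hn ht.le)
  · filter_upwards [self_mem_nhdsWithin] with t (ht : 0 < t)
    rw [div_le_iff₀ (by positivity)]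
    exact (measureReal_gammaMeasure_Iio_le hn ht.le).trans_eq (by ring)

/-- For `t ≤ 1` lowering the exponent only weakens the bound; for `t ≥ 1` the right side exceeds
one. The free exponent `s` can be chosen small enough for a negative moment of the other factor to
be finite. -/
lemma measureReal_gammaMeasure_Iio_le_rpow {n : ℕ} (hn : 1 ≤ n) {s t : ℝ} (hs : 0 ≤ s)
    (hsn : s ≤ n) (ht : 0 < t) : (gammaMeasure n 1).real (Set.Iio t) ≤ t ^ s := by
  have := isProbabilityMeasure_gammaMeasure_natCast hn
  rcases le_total t 1 with h | h
  · refine (measureReal_gammaMeasure_Iio_le hn ht.le).trans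
      ((div_le_self (by positivity) (by exact_mod_cast n.factorial_pos)).trans ?_)
    rw [← Real.rpow_natCast]
    exact Real.rpow_le_rpow_of_exponent_ge ht h hsn
  · exact measureReal_le_one.trans (Real.one_le_rpow h hs)

/-! ### Lower tail of a product of independent Gamma variables -/

/-- Distribution function of the product of two independent Gamma variables. -/
lemma measureReal_prod_gammaMeasure_mul_lt {m n : ℕ} (hm : 1 ≤ m) (hn : 1 ≤ n) (t : ℝ) :
    ((gammaMeasure m 1).prod (gammaMeasure n 1)).real {p | p.1 * p.2 < t} =
      ∫ s, (gammaMeasure n 1).real (Set.Iio (t / s)) ∂(gammaMeasure m 1) := by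
  have := isProbabilityMeasure_gammaMeasure_natCast hm
  have := isProbabilityMeasure_gammaMeasure_natCast hn
  have hms : MeasurableSet {p : ℝ × ℝ | p.1 * p.2 < t} :=
    measurableSet_lt (by fun_prop) measurable_const
  rw [measureReal_def, Measure.prod_apply hms, ← integral_toReal
    (measurable_measure_prodMk_left hms).aemeasurable (by simp)]
  refine integral_congr_ae ?_
  filter_upwards [ae_pos_gammaMeasure] with s hs
  rw [measureReal_def]
  congr 2
  ext w
  simp [lt_div_iff₀ hs, mul_comm]

lemma aestronglyMeasurable_measureReal_Iio_div {n : ℕ} (μ : Measure ℝ) (hn : 1 ≤ n) (t : ℝ) :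
    AEStronglyMeasurable (fun s => (gammaMeasure n 1).real (Set.Iio (t / s))) μ := by
  have := isProbabilityMeasure_gammaMeasure_natCast hn
  have h : Monotone fun y => (gammaMeasure n 1).real (Set.Iio y) := fun x y hxy =>
    measureReal_mono (Set.Iio_subset_Iio hxy)
  exact (h.measurable.comp (measurable_const.div measurable_id)).aestronglyMeasurable

/-- Lower tail of a product of independent Gamma variables whose first shape is the larger one. -/
lemma tendsto_measureReal_prod_gammaMeasure_mul_lt {m n : ℕ} (hn : 1 ≤ n) (hnm : n < m) {c : ℝ}
    (hc : 0 < c) :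
    Tendsto (fun ε => ((gammaMeasure m 1).prod (gammaMeasure n 1)).real {p | p.1 * p.2 < c * ε} /
      ε ^ n) (𝓝[>] 0) (𝓝 (c ^ n / n.factorial * (Real.Gamma ((m : ℝ) - n) / Real.Gamma m))) := by
  have hm : 1 ≤ m := by omega
  have hm0 : (0 : ℝ) < m := by exact_mod_cast hm
  have hnm' : (n : ℝ) < m := by exact_mod_cast hnm
  simp_rw [measureReal_prod_gammaMeasure_mul_lt hm hn, ← integral_div]
  rw [← integral_rpow_neg_gammaMeasure hm0 hnm', ← integral_const_mul]
  -- The pointwise limit itself dominates the integrand for all `ε > 0`, and it is integrable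
  -- because `n < m`.
  refine tendsto_integral_filter_of_dominated_convergence
    (fun s => c ^ n / n.factorial * s ^ (-n : ℝ)) ?_ ?_
    ((integrable_rpow_neg_gammaMeasure hm0 hnm').const_mul _) ?_
  · exact Eventually.of_forall fun ε =>
      (aestronglyMeasurable_measureReal_Iio_div _ hn _).mul_const _
  · filter_upwards [self_mem_nhdsWithin] with ε (hε : 0 < ε)
    filter_upwards [ae_pos_gammaMeasure] with s hs
    rw [Real.norm_of_nonneg (by positivity), div_le_iff₀ (by positivity), Real.rpow_neg hs.le,
      Real.rpow_natCast]
    refine (measureReal_gammaMeasure_Iio_le hn (by positivity)).trans_eq ?_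
    rw [div_pow, mul_pow]
    field_simp
  · filter_upwards [ae_pos_gammaMeasure] with s hs
    have h1 : Tendsto (fun ε : ℝ => c * ε / s) (𝓝[>] 0) (𝓝[>] 0) := by
      refine tendsto_nhdsWithin_iff.2 ⟨?_, ?_⟩
      · have : Continuous fun ε : ℝ => c * ε / s := by fun_prop
        simpa using (this.tendsto 0).mono_left nhdsWithin_le_nhds
      · filter_upwards [self_mem_nhdsWithin] with ε (hε : 0 < ε)
        exact div_pos (mul_pos hc hε) hs
    have h2 := ((tendsto_measureReal_gammaMeasure_Iio hn).comp h1).mul_const ((c / s) ^ n)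
    have h3 : c ^ n / n.factorial * s ^ (-n : ℝ) = 1 / n.factorial * (c / s) ^ n := by
      rw [Real.rpow_neg hs.le, Real.rpow_natCast, div_pow]
      field_simp
    rw [h3]
    refine h2.congr' ?_
    filter_upwards [self_mem_nhdsWithin] with ε (hε : 0 < ε)
    simp only [Function.comp, div_pow, mul_pow]
    field_simp

/-- Lower tail of a product of independent Gamma variables whose second shape is at least the
first. -/
lemma tendsto_measureReal_prod_gammaMeasure_mul_lt_zero {m n k : ℕ} (hkm : k < m) (hkn : k < n)
    {c : ℝ} (hc : 0 < c) :
    Tendsto (fun ε => ((gammaMeasure m 1).prod (gammaMeasure n 1)).real {p | p.1 * p.2 < c * ε} /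
      ε ^ k) (𝓝[>] 0) (𝓝 0) := by
  have hm : 1 ≤ m := by omega
  have hn : 1 ≤ n := by omega
  have hm0 : (0 : ℝ) < m := by exact_mod_cast hm
  -- The exponent `k + 1 / 2` lies strictly between `k` and both shapes: the moment is finite and a
  -- factor `ε ^ (1 / 2)` is left over.
  have hsm : (k : ℝ) + 1 / 2 < m := by
    have : (k : ℝ) + 1 ≤ m := by exact_mod_cast hkm
    linarith
  have hsn : (k : ℝ) + 1 / 2 ≤ n := by
    have : (k : ℝ) + 1 ≤ n := by exact_mod_cast hkn
    linarith
  have hi := integrable_rpow_neg_gammaMeasure hm0 hsm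
  set A := ∫ x, x ^ (-((k : ℝ) + 1 / 2)) ∂(gammaMeasure m 1)
  have hlim : Tendsto (fun ε : ℝ => c ^ ((k : ℝ) + 1 / 2) * A * ε ^ (1 / 2 : ℝ)) (𝓝[>] 0) (𝓝 0) := by
    have : Continuous fun ε : ℝ => c ^ ((k : ℝ) + 1 / 2) * A * ε ^ (1 / 2 : ℝ) :=
      continuous_const.mul (Real.continuous_rpow_const (by norm_num))
    simpa using (this.tendsto 0).mono_left nhdsWithin_le_nhds
  refine tendsto_of_tendsto_of_tendsto_of_le_of_le' tendsto_const_nhds hlim ?_ ?_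
  · filter_upwards [self_mem_nhdsWithin] with ε (hε : 0 < ε)
    positivity
  · filter_upwards [self_mem_nhdsWithin] with ε (hε : 0 < ε)
    rw [div_le_iff₀ (by positivity), measureReal_prod_gammaMeasure_mul_lt hm hn]
    have h1 : c ^ ((k : ℝ) + 1 / 2) * A * ε ^ (1 / 2 : ℝ) * ε ^ k =
        ∫ x, (c * ε) ^ ((k : ℝ) + 1 / 2) * x ^ (-((k : ℝ) + 1 / 2)) ∂(gammaMeasure m 1) := by
      rw [integral_const_mul, Real.mul_rpow hc.le hε.le, Real.rpow_add hε, Real.rpow_natCast]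
      ring
    rw [h1]
    refine integral_mono_of_nonneg (Eventually.of_forall fun s => measureReal_nonneg)
      (hi.const_mul _) ?_
    filter_upwards [ae_pos_gammaMeasure] with s hs
    refine (measureReal_gammaMeasure_Iio_le_rpow hn (by positivity) hsn
      (by positivity)).trans_eq ?_
    rw [Real.div_rpow (by positivity) hs.le, Real.rpow_neg hs.le, div_eq_mul_inv]

/-! ### Probability that at least one hop fails -/

section OutageEvent

variable {Ω : Type*} [MeasurableSpace Ω] {P : Measure Ω} {X S W : Ω → ℝ} {a b : ℕ}

lemma tendsto_pow_div_pow_nhdsGT_zero {j k : ℕ} (h : j < k) :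
    Tendsto (fun ε : ℝ => ε ^ k / ε ^ j) (𝓝[>] 0) (𝓝 0) := by
  have h1 : Tendsto (fun ε : ℝ => ε ^ (k - j)) (𝓝[>] 0) (𝓝 0) := by
    have := ((continuous_pow (M := ℝ) (k - j)).tendsto 0).mono_left
      (nhdsWithin_le_nhds (s := Set.Ioi 0))
    rwa [zero_pow (by omega)] at this
  refine h1.congr' ?_
  filter_upwards [self_mem_nhdsWithin] with ε (hε : 0 < ε)
  rw [eq_div_iff (by positivity), ← pow_add]
  congr 1
  omega

lemma tendsto_div_pow_of_lt {f : ℝ → ℝ} {L : ℝ} {j k : ℕ} (h : j < k)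
    (hf : Tendsto (fun ε => f ε / ε ^ k) (𝓝[>] 0) (𝓝 L)) :
    Tendsto (fun ε => f ε / ε ^ j) (𝓝[>] 0) (𝓝 0) := by
  have h1 := hf.mul (tendsto_pow_div_pow_nhdsGT_zero h)
  rw [mul_zero] at h1
  refine h1.congr' ?_
  filter_upwards [self_mem_nhdsWithin] with ε (hε : 0 < ε)
  field_simp

lemma measureReal_first_lt (hb : 1 ≤ b)
    (hXW : HasLaw (fun ω => (X ω, W ω)) ((gammaMeasure a 1).prod (gammaMeasure b 1)) P) (ε : ℝ) :
    P.real {ω | X ω < ε} = (gammaMeasure a 1).real (Set.Iio ε) := by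
  have := isProbabilityMeasure_gammaMeasure_natCast hb
  rw [hXW.measureReal_eq (p := fun p => p.1 < ε) (measurableSet_lt measurable_fst measurable_const)]
  have : {p : ℝ × ℝ | p.1 < ε} = Set.Iio ε ×ˢ Set.univ := by ext; simp
  rw [this, measureReal_prod_prod]
  simp

lemma measureReal_mul_lt {m : ℕ}
    (hSW : HasLaw (fun ω => (S ω, W ω)) ((gammaMeasure m 1).prod (gammaMeasure b 1)) P)
    (t : ℝ) : P.real {ω | S ω * W ω < t} =
      ((gammaMeasure m 1).prod (gammaMeasure b 1)).real {p | p.1 * p.2 < t} :=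
  hSW.measureReal_eq (p := fun p => p.1 * p.2 < t)
    (measurableSet_lt (by fun_prop) measurable_const)

/-- Both failures occur together with probability of lower order than the first one alone. -/
lemma tendsto_measureReal_inter_div_pow [IsProbabilityMeasure P] (ha : 1 ≤ a) (hb : 1 ≤ b)
    (hXW : HasLaw (fun ω => (X ω, W ω)) ((gammaMeasure a 1).prod (gammaMeasure b 1)) P)
    (hSW : HasLaw (fun ω => (S ω, W ω))
      ((gammaMeasure (a + 1 : ℕ) 1).prod (gammaMeasure b 1)) P) {c : ℝ} (hc : 0 < c) :
    Tendsto (fun ε => P.real ({ω | X ω < ε} ∩ {ω | S ω * W ω < c * ε}) / ε ^ a)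
      (𝓝[>] 0) (𝓝 0) := by
  have := isProbabilityMeasure_gammaMeasure_natCast ha
  have := isProbabilityMeasure_gammaMeasure_natCast hb
  have := isProbabilityMeasure_gammaMeasure_natCast (n := a + 1) (by omega)
  -- With `δ = ε ^ r` one has `δ ^ (a + 1) = ε ^ (1 / 2)`. Thus `δ → 0`, yet slowly enough that `(c
  -- * ε / δ) ^ (a + 1)` is still of order `ε ^ (a + 1 / 2)`.
  set r : ℝ := 1 / (2 * ((a + 1 : ℕ) : ℝ)) with hr
  have hr0 : 0 < r := by positivity
  have hlim : Tendsto (fun ε : ℝ => (ε ^ r) ^ b + c ^ (a + 1) * ε ^ (1 / 2 : ℝ)) (𝓝[>] 0) (𝓝 0) := by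
    have : Continuous fun ε : ℝ => (ε ^ r) ^ b + c ^ (a + 1) * ε ^ (1 / 2 : ℝ) :=
      ((Real.continuous_rpow_const hr0.le).pow b).add
        (continuous_const.mul (Real.continuous_rpow_const (by norm_num)))
    have h := (this.tendsto 0).mono_left (nhdsWithin_le_nhds (s := Set.Ioi 0))
    rwa [Real.zero_rpow hr0.ne', Real.zero_rpow (by norm_num), zero_pow (by omega), mul_zero,
      add_zero] at h
  refine tendsto_of_tendsto_of_tendsto_of_le_of_le' tendsto_const_nhds hlim ?_ ?_
  · filter_upwards [self_mem_nhdsWithin] with ε (hε : 0 < ε)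
    positivity
  · filter_upwards [self_mem_nhdsWithin] with ε (hε : 0 < ε)
    rw [div_le_iff₀ (by positivity)]
    set δ := ε ^ r
    have hδ : 0 < δ := by positivity
    have hS : ∀ᵐ ω ∂P, 0 < S ω := by
      have h := hSW.ae_iff (p := fun p : ℝ × ℝ => 0 < p.1) (by fun_prop)
      exact h.2 (Measure.quasiMeasurePreserving_fst.ae ae_pos_gammaMeasure)
    -- Splitting on `W < δ` avoids the joint law of `X` and `S`: the first piece uses independence
    -- of `X` and `W`, and `W ≥ δ` forces `S` to be small.
    have h1 : P.real ({ω | X ω < ε} ∩ {ω | S ω * W ω < c * ε}) ≤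
        P.real ({ω | X ω < ε ∧ W ω < δ} ∪ {ω | S ω < c * ε / δ}) := by
      refine ENNReal.toReal_mono (measure_ne_top _ _) (measure_mono_ae ?_)
      filter_upwards [hS] with ω hω h
      rcases lt_or_ge (W ω) δ with hw | hw
      · exact Or.inl ⟨h.1, hw⟩
      · refine Or.inr ((lt_div_iff₀ hδ).2 (lt_of_le_of_lt ?_ h.2))
        gcongr
    have h2 : P.real {ω | X ω < ε ∧ W ω < δ} ≤ ε ^ a * δ ^ b := by
      rw [hXW.measureReal_eq (p := fun p => p.1 < ε ∧ p.2 < δ)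
        ((measurableSet_lt measurable_fst measurable_const).inter
          (measurableSet_lt measurable_snd measurable_const))]
      have : {p : ℝ × ℝ | p.1 < ε ∧ p.2 < δ} = Set.Iio ε ×ˢ Set.Iio δ := by ext; simp
      rw [this, measureReal_prod_prod]
      gcongr
      · exact (measureReal_gammaMeasure_Iio_le ha hε.le).trans
          (div_le_self (by positivity) (by exact_mod_cast a.factorial_pos))
      · exact (measureReal_gammaMeasure_Iio_le hb hδ.le).trans
          (div_le_self (by positivity) (by exact_mod_cast b.factorial_pos))
    have h3 : P.real {ω | S ω < c * ε / δ} ≤ (c * ε / δ) ^ (a + 1) := by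
      rw [measureReal_first_lt hb hSW]
      exact (measureReal_gammaMeasure_Iio_le (by omega) (by positivity)).trans
          (div_le_self (by positivity) (by exact_mod_cast (a + 1).factorial_pos))
    have h4 : δ ^ (a + 1) * ε ^ (1 / 2 : ℝ) = ε := by
      rw [← Real.rpow_natCast, ← Real.rpow_mul hε.le, ← Real.rpow_add hε]
      have : r * (a + 1 : ℕ) + 1 / 2 = 1 := by rw [hr]; field_simp; norm_num
      rw [this, Real.rpow_one]
    have h5 : (c * ε / δ) ^ (a + 1) = c ^ (a + 1) * ε ^ (1 / 2 : ℝ) * ε ^ a := by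
      rw [div_pow, div_eq_iff (by positivity), mul_pow, pow_succ ε]
      nth_rewrite 2 [← h4]
      ring
    have h6 := measureReal_union_le (μ := P) {ω | X ω < ε ∧ W ω < δ} {ω | S ω < c * ε / δ}
    linarith

/-- Asymptotics of the probability that one of the two hops fails. -/
lemma tendsto_measureReal_union_div_pow [IsProbabilityMeasure P] (ha : 1 ≤ a) (hb : 1 ≤ b)
    (hXW : HasLaw (fun ω => (X ω, W ω)) ((gammaMeasure a 1).prod (gammaMeasure b 1)) P)
    (hSW : HasLaw (fun ω => (S ω, W ω))
      ((gammaMeasure (a + 1 : ℕ) 1).prod (gammaMeasure b 1)) P) {c : ℝ} (hc : 0 < c) :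
    (a < b → Tendsto (fun ε => P.real {ω | X ω < ε ∨ S ω * W ω < c * ε} / ε ^ a) (𝓝[>] 0)
      (𝓝 (1 / a.factorial))) ∧
    (a = b → Tendsto (fun ε => P.real {ω | X ω < ε ∨ S ω * W ω < c * ε} / ε ^ b) (𝓝[>] 0)
      (𝓝 (1 / a.factorial * (1 + 1 / b.factorial * c ^ b)))) ∧
    (b < a → Tendsto (fun ε => P.real {ω | X ω < ε ∨ S ω * W ω < c * ε} / ε ^ b) (𝓝[>] 0)
      (𝓝 (Real.Gamma ((a + 1 : ℕ) - b) / (a.factorial * b.factorial) * c ^ b))) := by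
  have hA : Tendsto (fun ε => P.real {ω | X ω < ε} / ε ^ a) (𝓝[>] 0) (𝓝 (1 / a.factorial)) := by
    simp_rw [measureReal_first_lt hb hXW]
    exact tendsto_measureReal_gammaMeasure_Iio ha
  have hC := tendsto_measureReal_inter_div_pow ha hb hXW hSW hc
  have hF : ∀ (k : ℕ) (ε : ℝ), P.real {ω | X ω < ε ∨ S ω * W ω < c * ε} / ε ^ k =
      P.real {ω | X ω < ε} / ε ^ k + P.real {ω | S ω * W ω < c * ε} / ε ^ k -
        P.real ({ω | X ω < ε} ∩ {ω | S ω * W ω < c * ε}) / ε ^ k := fun k ε => by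
    have hms : NullMeasurableSet {ω | S ω * W ω < c * ε} P :=
      hSW.aemeasurable.nullMeasurable
        (measurableSet_lt (measurable_fst.mul measurable_snd) measurable_const)
    have h := measureReal_union_add_inter₀ (μ := P) (s := {ω | X ω < ε}) hms
    rw [← add_div, ← sub_div, ← h, add_sub_cancel_right]
    rfl
  have hfac : Real.Gamma (a + 1 : ℕ) = a.factorial := by
    rw [Nat.cast_succ, Real.Gamma_nat_eq_factorial]
  simp_rw [hF]
  -- `S` has shape `a + 1`, so the boundary case `b = a` still has a finite moment.
  have hB : b ≤ a → Tendsto (fun ε => P.real {ω | S ω * W ω < c * ε} / ε ^ b) (𝓝[>] 0)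
      (𝓝 (c ^ b / b.factorial * (Real.Gamma ((a + 1 : ℕ) - b) / a.factorial))) := fun h => by
    simp_rw [measureReal_mul_lt hSW]
    rw [← hfac]
    exact tendsto_measureReal_prod_gammaMeasure_mul_lt hb (by omega) hc
  refine ⟨fun h => ?_, fun h => ?_, fun h => ?_⟩
  · have hB0 : Tendsto (fun ε => P.real {ω | S ω * W ω < c * ε} / ε ^ a) (𝓝[>] 0) (𝓝 0) := by
      simp_rw [measureReal_mul_lt hSW]
      exact tendsto_measureReal_prod_gammaMeasure_mul_lt_zero (by omega) h hc
    simpa using (hA.add hB0).sub hC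
  · subst h
    convert (hA.add (hB le_rfl)).sub hC using 2
    have : Real.Gamma ((a + 1 : ℕ) - a) = 1 := by push_cast; simp
    rw [this]
    ring
  -- The first-hop and joint terms are controlled at order `ε ^ a`, hence vanish against `ε ^ b`.
  · convert ((tendsto_div_pow_of_lt h hA).add (hB h.le)).sub (tendsto_div_pow_of_lt h hC) using 2
    ring

end OutageEvent

/-! ### From limits of quotients to equivalence and diversity order -/

lemma isEquivalent_of_tendsto_div_pow {f : ℝ → ℝ} {L K : ℝ} {k : ℕ} (hL : 0 < L)
    (h : Tendsto (fun ρ => f ρ / (K / ρ) ^ k) atTop (𝓝 L)) :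
    f ~[atTop] fun ρ => L * (K / ρ) ^ k := by
  refine isEquivalent_of_tendsto_one ?_
  have h1 := h.div_const L
  rw [div_self hL.ne'] at h1
  refine h1.congr fun ρ => ?_
  simp only [Pi.div_apply]
  rw [div_div, mul_comm]

/-- Since `L > 0`, the logarithm of the quotient converges, so it is negligible after division by
`log ρ`; only the power `k` survives. -/
lemma hasDiversityOrder_of_tendsto_div_pow {f : ℝ → ℝ} {L K : ℝ} {k : ℕ} (hL : 0 < L) (hK : 0 < K)
    (h : Tendsto (fun ρ => f ρ / (K / ρ) ^ k) atTop (𝓝 L)) : HasDiversityOrder f k := by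
  have h1 : Tendsto (fun ρ => -(Real.log (f ρ / (K / ρ) ^ k) + k * Real.log K) / Real.log ρ + k)
      atTop (𝓝 (0 + k)) :=
    (((h.log hL.ne').add_const _).neg.div_atTop Real.tendsto_log_atTop).add_const _
  rw [zero_add] at h1
  refine h1.congr' ?_
  filter_upwards [eventually_gt_atTop 1, h.eventually (lt_mem_nhds hL)] with ρ hρ hf
  have hρ0 : 0 < ρ := by linarith
  have hp : 0 < (K / ρ) ^ k := by positivity
  have hf0 : 0 < f ρ := (div_pos_iff_of_pos_right hp).1 hf
  have hl : 0 < Real.log ρ := Real.log_pos hρ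
  rw [Real.log_div hf0.ne' hp.ne', Real.log_pow, Real.log_div hK.ne' hρ0.ne']
  field_simp
  ring

/-! ### Algebra of the zero-forcing combiner -/

section ZeroForcing

variable {MR MT : ℕ} (x : Fin MR → ℂ) (H : Matrix (Fin MR) (Fin MT) ℂ) (w : Fin MT → ℂ)

lemma star_dotProduct_self (x : Fin MR → ℂ) : star x ⬝ᵥ x = ((vecNorm x ^ 2 : ℝ) : ℂ) := by
  rw [vecNorm_sq, dotProduct]
  push_cast
  exact Finset.sum_congr rfl fun i _ => Complex.conj_mul' _

lemma rzfProjection_mulVec : rzfProjection H w *ᵥ x =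
    x - (((vecNorm (H *ᵥ star w) ^ 2)⁻¹ : ℂ) * (star (H *ᵥ star w) ⬝ᵥ x)) • (H *ᵥ star w) := by
  rw [rzfProjection, Matrix.sub_mulVec, Matrix.one_mulVec, Matrix.smul_mulVec,
    Matrix.vecMulVec_mulVec, mul_smul]
  simp

/-- The zero-forcing projection annihilates the received loopback direction. -/
lemma star_rzfProjection_mulVec_dotProduct :
    star (rzfProjection H w *ᵥ x) ⬝ᵥ (H *ᵥ star w) = 0 := by
  rw [rzfProjection_mulVec]
  set u := H *ᵥ star w
  rw [star_sub, star_smul, sub_dotProduct, smul_dotProduct, star_dotProduct_self]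
  have h : star x ⬝ᵥ u = star (star u ⬝ᵥ x) := by
    rw [Matrix.star_dotProduct]
  rcases eq_or_ne (vecNorm u) 0 with h0 | h0
  -- If the loopback direction vanishes, the identity is trivial, so no nondegeneracy is required
  -- here.
  · have : u = 0 := vecNorm_eq_zero.1 h0
    simp [this]
  · have h0' : (vecNorm u : ℂ) ≠ 0 := by exact_mod_cast h0
    rw [h]
    simp only [star_mul', star_inv₀, star_pow, Complex.star_def, Complex.conj_ofReal, smul_eq_mul]
    push_cast
    field_simp
    simp

/-- `x` and `D x` differ by a multiple of the loopback direction, which is orthogonal to `D x`.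
Hence the combiner output has modulus `‖D x‖`. -/
lemma star_rzfProjection_mulVec_dotProduct_self :
    star (rzfProjection H w *ᵥ x) ⬝ᵥ x = ((vecNorm (rzfProjection H w *ᵥ x) ^ 2 : ℝ) : ℂ) := by
  have h := star_rzfProjection_mulVec_dotProduct x H w
  rw [← star_dotProduct_self]
  nth_rewrite 3 [rzfProjection_mulVec]
  rw [dotProduct_sub, dotProduct_smul, h, smul_zero, sub_zero]

/-- Pythagoras, in the form whose law is given by `hasLaw_vecNorm_orthogonal_sq`. -/
lemma vecNorm_rzfProjection_mulVec_sq : vecNorm (rzfProjection H w *ᵥ x) ^ 2 =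
    vecNorm x ^ 2 - ‖star (H *ᵥ star w) ⬝ᵥ x‖ ^ 2 / vecNorm (H *ᵥ star w) ^ 2 := by
  have h := star_rzfProjection_mulVec_dotProduct_self x H w
  nth_rewrite 1 [rzfProjection_mulVec] at h
  set u := H *ᵥ star w
  rw [star_sub, star_smul, sub_dotProduct, smul_dotProduct, star_dotProduct_self, smul_eq_mul,
    star_mul', mul_assoc, Complex.star_def, Complex.conj_mul'] at h
  rw [← Complex.ofReal_inj, ← h]
  simp [div_eq_inv_mul]

/-- Under receive zero-forcing the loopback interference vanishes. -/
lemma rzfSinr_eq (κ τ d₁ d₂ ρ : ℝ) : rzfSinr κ τ d₁ d₂ ρ x H w =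
    min (ρ * vecNorm (rzfProjection H w *ᵥ x) ^ 2 / d₁ ^ τ)
      (κ * ρ / (d₁ ^ τ * d₂ ^ τ) * (vecNorm x ^ 2 * vecNorm w ^ 2)) := by
  have h1 : rzfCombiner x H w ⬝ᵥ (H *ᵥ mrtBeamformer w) = 0 := by
    rw [rzfCombiner, mrtBeamformer, Matrix.mulVec_smul, dotProduct_smul, smul_dotProduct,
      star_rzfProjection_mulVec_dotProduct, smul_zero, smul_zero]
  have h2 : ‖rzfCombiner x H w ⬝ᵥ x‖ = vecNorm (rzfProjection H w *ᵥ x) := by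
    rw [rzfCombiner, smul_dotProduct, star_rzfProjection_mulVec_dotProduct_self, norm_smul,
      norm_inv, Complex.norm_real, Complex.norm_real, Real.norm_of_nonneg (vecNorm_nonneg _),
      Real.norm_of_nonneg (by positivity)]
    rcases eq_or_ne (vecNorm (rzfProjection H w *ᵥ x)) 0 with h | h
    · simp [h]
    · field_simp
  have h3 : ‖w ⬝ᵥ mrtBeamformer w‖ = vecNorm w := by
    rw [mrtBeamformer, dotProduct_smul, dotProduct_comm, star_dotProduct_self, norm_smul,
      norm_inv, Complex.norm_real, Complex.norm_real, Real.norm_of_nonneg (vecNorm_nonneg _),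
      Real.norm_of_nonneg (by positivity)]
    rcases eq_or_ne (vecNorm w) 0 with h | h
    · simp [h]
    · field_simp
  rw [rzfSinr, sinr, h1, h2, h3]
  simp [mul_assoc]

end ZeroForcing

lemma rzfSinr_lt_iff {MR MT : ℕ} (x : Fin MR → ℂ) (H : Matrix (Fin MR) (Fin MT) ℂ)
    (w : Fin MT → ℂ) {κ τ d₁ d₂ ρ z : ℝ} (hκ : 0 < κ) (hd₁ : 0 < d₁) (hd₂ : 0 < d₂) (hρ : 0 < ρ) :
    rzfSinr κ τ d₁ d₂ ρ x H w < z ↔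
      vecNorm (rzfProjection H w *ᵥ x) ^ 2 < d₁ ^ τ * z / ρ ∨
        vecNorm x ^ 2 * vecNorm w ^ 2 < d₂ ^ τ / κ * (d₁ ^ τ * z / ρ) := by
  have h₁ : 0 < d₁ ^ τ := by positivity
  have h₂ : 0 < d₂ ^ τ := by positivity
  rw [rzfSinr_eq, min_lt_iff, div_lt_iff₀ h₁, lt_div_iff₀ hρ, mul_comm z, mul_comm ρ]
  refine or_congr Iff.rfl ?_
  rw [div_mul_eq_mul_div, div_lt_iff₀ (by positivity), div_mul_div_comm, lt_div_iff₀ (by positivity)]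
  constructor <;> intro h <;> linarith

/-! ### Joint laws of the hop gains -/

section ChannelLaws

variable {MR MT : ℕ} {v : ℝ≥0}

/-- A statistic of the source channel whose conditional law given the other channels is fixed is
independent of the second hop gain. -/
lemma hasLaw_rayleighLaw_prod (hMT : 1 ≤ MT) {γ : Measure ℝ} [IsProbabilityMeasure γ]
    {f : (Fin MR → Fin MT → ℂ) × (Fin MT → ℂ) → (Fin MR → ℂ) → ℝ}
    (hf : Measurable (Function.uncurry f))
    (h : ∀ᵐ q ∂((Measure.pi fun _ : Fin MR => Measure.pi fun _ : Fin MT => complexGaussian v).prod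
      (Measure.pi fun _ : Fin MT => complexGaussian 1)),
      (Measure.pi fun _ : Fin MR => complexGaussian 1).map (f q) = γ) :
    HasLaw (fun p => (f p.2 p.1, vecNorm p.2.2 ^ 2)) (γ.prod (gammaMeasure MT 1))
      (rayleighLaw MR MT v) := by
  have := isProbabilityMeasure_gammaMeasure_natCast hMT
  have h1 : MeasurePreserving (fun w : Fin MT → ℂ => vecNorm w ^ 2)
      (Measure.pi fun _ : Fin MT => complexGaussian 1) (gammaMeasure MT 1) :=
    ⟨by fun_prop, (hasLaw_vecNorm_sq hMT).map_eq⟩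
  -- A fibre map with almost surely constant image law turns the product into a product; the swaps
  -- below adapt the order of the factors, as the base comes first in a skew product.
  have h2 := (h1.comp (measurePreserving_snd
    (μ := Measure.pi fun _ : Fin MR => Measure.pi fun _ : Fin MT => complexGaussian v))).skew_product
      hf h
  exact ((Measure.measurePreserving_swap.comp h2).comp Measure.measurePreserving_swap).hasLaw

lemma hasLaw_source_gain (hMR : 1 ≤ MR) (hMT : 1 ≤ MT) :
    HasLaw (fun p => (vecNorm p.1 ^ 2, vecNorm p.2.2 ^ 2))
      ((gammaMeasure MR 1).prod (gammaMeasure MT 1)) (rayleighLaw MR MT v) := by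
  have := isProbabilityMeasure_gammaMeasure_natCast hMR
  exact hasLaw_rayleighLaw_prod hMT (f := fun _ x => vecNorm x ^ 2)
    (by simp only [Function.uncurry_def]; fun_prop)
    (Eventually.of_forall fun _ => (hasLaw_vecNorm_sq hMR).map_eq)

lemma hasLaw_rzf_gain {n : ℕ} (hn : 1 ≤ n) (hMT : 1 ≤ MT) (hv : v ≠ 0) :
    HasLaw (fun p : (Fin (n + 1) → ℂ) × (Fin (n + 1) → Fin MT → ℂ) × (Fin MT → ℂ) =>
        (vecNorm (rzfProjection (Matrix.of p.2.1) p.2.2 *ᵥ p.1) ^ 2, vecNorm p.2.2 ^ 2))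
      ((gammaMeasure n 1).prod (gammaMeasure MT 1)) (rayleighLaw (n + 1) MT v) := by
  have := isProbabilityMeasure_gammaMeasure_natCast hn
  have hu : Measurable fun q : (Fin (n + 1) → Fin MT → ℂ) × (Fin MT → ℂ) =>
      Matrix.of q.1 *ᵥ star q.2 := by
    refine measurable_pi_iff.2 fun i => ?_
    simp only [Matrix.mulVec, dotProduct, Matrix.of_apply, Pi.star_apply]
    fun_prop
  have hum : MeasurableSet {q : (Fin (n + 1) → Fin MT → ℂ) × (Fin MT → ℂ) |
      Matrix.of q.1 *ᵥ star q.2 ≠ 0} := (hu (measurableSet_singleton 0)).compl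
  refine hasLaw_rayleighLaw_prod hMT
    (f := fun q x => vecNorm (rzfProjection (Matrix.of q.1) q.2 *ᵥ x) ^ 2) ?_ ?_
  · simp only [Function.uncurry_def, vecNorm_rzfProjection_mulVec_sq]
    have hd : Measurable fun p : ((Fin (n + 1) → Fin MT → ℂ) × (Fin MT → ℂ)) × (Fin (n + 1) → ℂ) =>
        star (Matrix.of p.1.1 *ᵥ star p.1.2) ⬝ᵥ p.2 := by
      simp only [dotProduct, Pi.star_apply]
      fun_prop
    exact ((measurable_vecNorm.comp measurable_snd).pow_const 2).sub
      ((hd.norm.pow_const 2).div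
        ((measurable_vecNorm.comp (hu.comp measurable_fst)).pow_const 2))
  · have hae : ∀ᵐ q ∂((Measure.pi fun _ : Fin (n + 1) =>
        Measure.pi fun _ : Fin MT => complexGaussian v).prod
        (Measure.pi fun _ : Fin MT => complexGaussian 1)), Matrix.of q.1 *ᵥ star q.2 ≠ 0 := by
      -- Fubini in the other order: for a fixed nonzero `w`, almost every `H` has `H w† ≠ 0`.
      refine (Measure.ae_prod_iff_ae_ae hum).2 ((Measure.ae_ae_comm hum).2 ?_)
      filter_upwards [ae_ne_zero_pi_complexGaussian hMT one_ne_zero] with w hw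
      exact ae_mulVec_ne_zero (by omega) hv (star_ne_zero.2 hw)
    filter_upwards [hae] with q hq
    simp only [vecNorm_rzfProjection_mulVec_sq]
    exact (hasLaw_vecNorm_orthogonal_sq hn hq).map_eq

end ChannelLaws

end FDRelay

/-! ### Assembly of the outage asymptotics -/

theorem proposition2 {Ω : Type*} [MeasurableSpace Ω] (P : Measure Ω) [IsProbabilityMeasure P]
    (MR MT : ℕ) (hMR : 1 < MR) (hMT : 1 ≤ MT)
    (v : ℝ≥0) (hv : 0 < v)
    (hSR : Ω → Fin MR → ℂ) (HRR : Ω → Fin MR → Fin MT → ℂ) (hRD : Ω → Fin MT → ℂ)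
    (hlaw : HasLaw (fun ω => (hSR ω, HRR ω, hRD ω)) (FDRelay.rayleighLaw MR MT v) P)
    (η α τ d₁ d₂ z : ℝ) (hη : 0 < η) (hα₀ : 0 < α) (hα₁ : α < 1)
    (hd₁ : 0 < d₁) (hd₂ : 0 < d₂) (hz : 0 < z)
    (κ : ℝ) (hκ : κ = FDRelay.kappa η α)
    (Pout : ℝ → ℝ)
    (hPout : ∀ ρ₁ : ℝ, Pout ρ₁ = FDRelay.outageProb P
      (fun ω => FDRelay.rzfSinr κ τ d₁ d₂ ρ₁ (hSR ω) (Matrix.of (HRR ω)) (hRD ω)) z) :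
    (MR < MT + 1 →
      Pout ~[atTop] fun ρ₁ => 1 / Real.Gamma MR * (d₁ ^ τ * z / ρ₁) ^ (MR - 1)) ∧
    (MR = MT + 1 →
      Pout ~[atTop] fun ρ₁ =>
        1 / Real.Gamma MR * (1 + 1 / Real.Gamma ((MT : ℝ) + 1) * (d₂ ^ τ / κ) ^ MT) *
          (d₁ ^ τ * z / ρ₁) ^ MT) ∧
    (MT + 1 < MR →
      Pout ~[atTop] fun ρ₁ =>
        Real.Gamma ((MR : ℝ) - MT) / (Real.Gamma MR * Real.Gamma ((MT : ℝ) + 1)) *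
          (d₂ ^ τ / κ) ^ MT * (d₁ ^ τ * z / ρ₁) ^ MT) ∧
    FDRelay.HasDiversityOrder Pout ((min (MR - 1) MT : ℕ) : ℝ) := by
  -- `a = MR - 1` is the Gamma shape left after projecting out one direction.
  obtain ⟨a, rfl⟩ : ∃ a, MR = a + 1 := ⟨MR - 1, by omega⟩
  have ha : 1 ≤ a := by omega
  have hκ0 : 0 < κ := by
    rw [hκ, FDRelay.kappa]
    exact div_pos (mul_pos hη hα₀) (sub_pos.2 hα₁)
  have hc : 0 < d₂ ^ τ / κ := by positivity
  have hK : 0 < d₁ ^ τ * z := by positivity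
  obtain ⟨h₁, h₂, h₃⟩ := FDRelay.tendsto_measureReal_union_div_pow ha hMT
    ((FDRelay.hasLaw_rzf_gain ha hMT hv.ne').fun_comp hlaw)
    ((FDRelay.hasLaw_source_gain (by omega) hMT).fun_comp hlaw) hc
  have hε : Tendsto (fun ρ : ℝ => d₁ ^ τ * z / ρ) atTop (𝓝[>] 0) := by
    refine tendsto_nhdsWithin_iff.2 ⟨tendsto_const_nhds.div_atTop tendsto_id, ?_⟩
    filter_upwards [eventually_gt_atTop 0] with ρ hρ
    exact div_pos hK hρ
  have hP : ∀ᶠ ρ in atTop, P.real {ω |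
      FDRelay.vecNorm (FDRelay.rzfProjection (Matrix.of (HRR ω)) (hRD ω) *ᵥ hSR ω) ^ 2 <
        d₁ ^ τ * z / ρ ∨ FDRelay.vecNorm (hSR ω) ^ 2 * FDRelay.vecNorm (hRD ω) ^ 2 <
        d₂ ^ τ / κ * (d₁ ^ τ * z / ρ)} = Pout ρ := by
    filter_upwards [eventually_gt_atTop 0] with ρ hρ
    rw [hPout, FDRelay.outageProb]
    simp_rw [FDRelay.rzfSinr_lt_iff _ _ _ hκ0 hd₁ hd₂ hρ]
  have hlim : ∀ {k : ℕ} {L : ℝ}, Tendsto (fun ε => P.real {ω |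
      FDRelay.vecNorm (FDRelay.rzfProjection (Matrix.of (HRR ω)) (hRD ω) *ᵥ hSR ω) ^ 2 < ε ∨
        FDRelay.vecNorm (hSR ω) ^ 2 * FDRelay.vecNorm (hRD ω) ^ 2 < d₂ ^ τ / κ * ε} / ε ^ k)
      (𝓝[>] 0) (𝓝 L) → Tendsto (fun ρ => Pout ρ / (d₁ ^ τ * z / ρ) ^ k) atTop (𝓝 L) :=
    fun h => (h.comp hε).congr' (hP.mono fun ρ hρ => by rw [Function.comp, hρ])
  have hΓa : Real.Gamma (a + 1 : ℕ) = a.factorial := by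
    rw [Nat.cast_succ, Real.Gamma_nat_eq_factorial]
  have hΓb : Real.Gamma ((MT : ℝ) + 1) = MT.factorial := Real.Gamma_nat_eq_factorial MT
  have hfa : (0 : ℝ) < a.factorial := by exact_mod_cast a.factorial_pos
  have hfb : (0 : ℝ) < MT.factorial := by exact_mod_cast MT.factorial_pos
  have hL₂ : 0 < 1 / (a.factorial : ℝ) * (1 + 1 / MT.factorial * (d₂ ^ τ / κ) ^ MT) := by positivity
  have hL₃ (h : MT < a) : 0 < Real.Gamma ((a + 1 : ℕ) - MT) / (a.factorial * MT.factorial) *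
      (d₂ ^ τ / κ) ^ MT := by
    have : (MT : ℝ) < (a + 1 : ℕ) := by exact_mod_cast h.trans a.lt_succ_self
    have := Real.Gamma_pos_of_pos (sub_pos.2 this)
    positivity
  rw [hΓa, hΓb, Nat.add_sub_cancel]
  refine ⟨fun h => ?_, fun h => ?_, fun h => ?_, ?_⟩
  · exact FDRelay.isEquivalent_of_tendsto_div_pow (by positivity) (hlim (h₁ (by omega)))
  · exact FDRelay.isEquivalent_of_tendsto_div_pow hL₂ (hlim (h₂ (by omega)))
  · exact FDRelay.isEquivalent_of_tendsto_div_pow (hL₃ (by omega)) (hlim (h₃ (by omega)))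
  · rcases lt_trichotomy a MT with h | h | h
    · rw [min_eq_left h.le]
      exact FDRelay.hasDiversityOrder_of_tendsto_div_pow (by positivity) hK (hlim (h₁ h))
    · rw [min_eq_right h.ge]
      exact FDRelay.hasDiversityOrder_of_tendsto_div_pow hL₂ hK (hlim (h₂ h))
    · rw [min_eq_right h.le]
      exact FDRelay.hasDiversityOrder_of_tendsto_div_pow (hL₃ h) hK (hlim (h₃ h))
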